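/- A 3XOR instance $I$ consists of finitely many variables and a finite multiset of constraints, each an equation $x+y+z=b$ over $\mathbb{F}_2$ on three distinct variables. For a real number $s$, $I$ is $s$-satisfiable if some assignment of values in $\mathbb{F}_2$ to the variables satisfies at least $sm$ of its $m$ constraints, counted with multiplicity; $I$ is satisfiable if some assignment satisfies all of them. An instance is regarded as a finite relational structure in one of two ways: (1) the universe is the disjoint union of the set of variables and the set of (occurrences of) constraints, with binary relations $E_1,E_2,E_3$, where $E_i(x,c)$ holds if $x$ is the $i$-th variable of $c$, and unary relations $Z_0,Z_1$, where $Z_b(c)$ holds if the constraint $c$ has right-hand side $b$; (2) for instances without repeated constraints: the universe is the set of variables, with ternary relations $R_0,R_1$, where $R_b(x,y,z)$ holds if $x+y+z=b$ is one of the constraints. For $k\in\mathbb{N}$, $C^k$ is the set of formulas of first-order logic with counting quantifiers $\exists^{i}$ ("there are at least $i$ elements such that") in which at most $k$ variables occur, free or bound, and $\mathbb{A}\equiv_{C^k}\mathbb{B}$ means that no sentence of $C^k$ distinguishes $\mathbb{A}$ from $\mathbb{B}$. For $k:\mathbb{N}\to\mathbb{N}$, two isomorphism-closed classes $\mathcal{C},\mathcal{D}$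 of finite structures are $C^k$-separable if for every $n$ and all $\mathbb{A}\in\mathcal{C}$, $\mathbb{B}\in\mathcal{D}$ with at most $n$ elements each, $\mathbb{A}\not\equiv_{C^{k(n)}}\mathbb{B}$. **Theorem.** Let $\varepsilon>0$ be real, and use either of the encodings (1), (2). Let $\mathcal{C}$ be the class of (structures isomorphic to encodings of) 3XOR instances that are satisfiable, and $\mathcal{D}$ the class of those that are not $(1/2+\varepsilon)$-satisfiable. Then $\mathcal{C}$ and $\mathcal{D}$ are not $C^k$-separable for any $k:\mathbb{N}\to\mathbb{N}$ with $k(n)=o(n)$. -/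

import Mathlib

/-! ### Counting logic with `k` variables -/

/-- Formulas of first-order logic with counting quantifiers over a relational vocabulary `L`, in
which only the `k` variables indexed by `Fin k` occur, free or bound (variables may be requantified).
The formula `exGe i x φ` says that at least `i` elements `x` satisfy `φ`; the ordinary quantifier
`∃ x` is `exGe 1 x`, and the other connectives and `∀` are the usual abbreviations. -/
inductive CountFormula (L : FirstOrder.Language.{0, 0}) (k : ℕ) : Type where
  | falsum : CountFormula L k
  | equal (x y : Fin k) : CountFormula L k
  | rel {r : ℕ} (R : L.Relations r) (x : Fin r → Fin k) : CountFormula L k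
  | neg (φ : CountFormula L k) : CountFormula L k
  | conj (φ ψ : CountFormula L k) : CountFormula L k
  | exGe (i : ℕ) (x : Fin k) (φ : CountFormula L k) : CountFormula L k

namespace CountFormula

/-- The free variables of a formula. -/
def freeVars {L : FirstOrder.Language.{0, 0}} {k : ℕ} : CountFormula L k → Finset (Fin k)
  | falsum => ∅
  | equal x y => {x, y}
  | rel _ x => Finset.univ.image x
  | neg φ => φ.freeVars
  | conj φ ψ => φ.freeVars ∪ ψ.freeVars
  | exGe _ x φ => φ.freeVars.erase x

/-- Truth of a formula in the structure `A` under the assignment `v` of elements to variables. -/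
def Realize {L : FirstOrder.Language.{0, 0}} {k : ℕ} {A : Type} [L.Structure A] :
    CountFormula L k → (Fin k → A) → Prop
  | falsum, _ => False
  | equal x y, v => v x = v y
  | rel R x, v => FirstOrder.Language.Structure.RelMap R (fun j => v (x j))
  | neg φ, v => ¬ φ.Realize v
  | conj φ ψ, v => φ.Realize v ∧ ψ.Realize v
  | exGe i x φ, v => (i : ℕ∞) ≤ Set.encard {a : A | φ.Realize (Function.update v x a)}

end CountFormula

/-- `A ≡ B` for `k`-variable counting logic: no sentence of `C^k` distinguishes `A` from `B`.
A sentence is a formula without free variables; its truth does not depend on the assignment. -/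
def CountEquiv (L : FirstOrder.Language.{0, 0}) [L.IsRelational] (k : ℕ)
    (A B : Type) [L.Structure A] [L.Structure B] : Prop :=
  ∀ φ : CountFormula L k, φ.freeVars = ∅ →
    ((∀ v : Fin k → A, φ.Realize v) ↔ (∀ v : Fin k → B, φ.Realize v))

/-- Two classes of finite structures are `C^k`-separable, for `k : ℕ → ℕ`, if for every `n` no
structure with at most `n` elements in the first class is `C^{k(n)}`-equivalent to a structure with
at most `n` elements in the second. -/
def CountSeparable (L : FirstOrder.Language.{0, 0}) [L.IsRelational] (k : ℕ → ℕ)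
    (C D : Set (CategoryTheory.Bundled.{0} L.Structure)) : Prop :=
  ∀ n : ℕ, ∀ A ∈ C, ∀ B ∈ D, Finite A → Finite B → Nat.card A ≤ n → Nat.card B ≤ n →
    ¬ CountEquiv L (k n) A B

/-! ### Systems of linear equations over `𝔽₂` with three distinct variables per equation -/

/-- An instance of 3XOR: finitely many variables and a finite multiset of constraints (an indexed
family), the constraint `c` being the equation
`var c 0 + var c 1 + var c 2 = rhs c` over `ZMod 2` on three distinct variables. -/
structure ThreeXor where
  Var : Type
  Con : Type
  [fintypeVar : Fintype Var]
  [fintypeCon : Fintype Con]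
  var : Con → Fin 3 → Var
  var_injective : ∀ c, Function.Injective (var c)
  rhs : Con → ZMod 2

namespace ThreeXor

attribute [instance] ThreeXor.fintypeVar ThreeXor.fintypeCon

/-- The assignment `f` satisfies the constraint `c`. -/
def Satisfies (I : ThreeXor) (f : I.Var → ZMod 2) (c : I.Con) : Prop :=
  f (I.var c 0) + f (I.var c 1) + f (I.var c 2) = I.rhs c

/-- Some assignment satisfies every constraint. -/
def Satisfiable (I : ThreeXor) : Prop :=
  ∃ f : I.Var → ZMod 2, ∀ c, I.Satisfies f c

/-- Some assignment satisfies at least `s * m` of the `m` constraints, with multiplicity. -/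
def FracSatisfiable (I : ThreeXor) (s : ℝ) : Prop :=
  ∃ f : I.Var → ZMod 2, s * (Nat.card I.Con : ℝ) ≤ (Nat.card {c : I.Con // I.Satisfies f c} : ℝ)

/-- No constraint occurs twice, so that the collection of constraints is a set. -/
def NoRepeat (I : ThreeXor) : Prop :=
  Function.Injective fun c : I.Con => (I.var c, I.rhs c)

/-! #### The encoding whose universe consists of the variables and the constraints -/

/-- `E i` (binary): "`x` is the `i`-th variable of the constraint `c`";
`Z b` (unary): "`c` is a constraint with right-hand side `b`". -/
inductive IncRel : ℕ → Type where
  | E (i : Fin 3) : IncRel 2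
  | Z (b : ZMod 2) : IncRel 1

/-- The vocabulary with the binary relations `E i` and the unary relations `Z b`. -/
def incLang : FirstOrder.Language.{0, 0} where
  Functions := fun _ => Empty
  Relations := IncRel

instance : incLang.IsRelational := fun _ => inferInstanceAs (IsEmpty Empty)

/-- The structure on variables and constraints that encodes `I`. -/
instance incStructure (I : ThreeXor) : incLang.Structure (I.Var ⊕ I.Con) where
  funMap := fun f => Empty.elim f
  RelMap := fun {_} R => match R with
    | IncRel.E i => fun a => ∃ c : I.Con, a 0 = Sum.inl (I.var c i) ∧ a 1 = Sum.inr c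
    | IncRel.Z b => fun a => ∃ c : I.Con, a 0 = Sum.inr c ∧ I.rhs c = b

/-- The class of structures isomorphic to the encoding of an instance with the property `P`. -/
def incClass (P : ThreeXor → Prop) : Set (CategoryTheory.Bundled.{0} incLang.Structure) :=
  {A | ∃ I : ThreeXor, P I ∧ Nonempty (incLang.Equiv A (I.Var ⊕ I.Con))}

/-! #### The encoding whose universe consists of the variables only -/

/-- `R b` (ternary): "`x + y + z = b` is a constraint". -/
inductive VarRel : ℕ → Type where
  | R (b : ZMod 2) : VarRel 3

/-- The vocabulary with the ternary relations `R b`. -/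
def varLang : FirstOrder.Language.{0, 0} where
  Functions := fun _ => Empty
  Relations := VarRel

instance : varLang.IsRelational := fun _ => inferInstanceAs (IsEmpty Empty)

/-- The structure on the variables that encodes the set of constraints of `I`. -/
instance varStructure (I : ThreeXor) : varLang.Structure I.Var where
  funMap := fun f => Empty.elim f
  RelMap := fun {_} R => match R with
    | VarRel.R b => fun a => ∃ c : I.Con, a = I.var c ∧ I.rhs c = b

/-- The class of structures isomorphic to the encoding of an instance with the property `P`. This
encoding forgets multiplicities, so instances are taken to have no repeated constraint. -/
def varClass (P : ThreeXor → Prop) : Set (CategoryTheory.Bundled.{0} varLang.Structure) :=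
  {A | ∃ I : ThreeXor, I.NoRepeat ∧ P I ∧ Nonempty (varLang.Equiv A I.Var)}

end ThreeXor

/-! Take `c * M` random equations in `3 * M` variables over 𝔽₂, with `c` a constant. Double each
variable x into (x,0) and (x,1), standing for x and x+1, and each equation into its eight
translates. Right-hand side 0 gives a satisfiable instance. For some right-hand side `b`, an
exponential moment bound and a union bound over assignments leave none satisfying a fraction 1/2 + ε
(`exists_not_fracSatisfiable_doubling`).

Interchanging (x,0) and (x,1) where `h x = 1` carries the `b`-instance to the 0-instance on every
equation that `h` solves. A global solution `h` need not exist, but `k` pebbles only see `3 * k`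
base variables. Expansion (`exists_expands`) lets a locally consistent `h` be extended one variable
at a time (`Expands.exists_insert`), which yields a winning strategy in the bijective `k`-pebble
game (`Expands.countEquiv`). Both the range `s` of expansion and the size of the instances are
linear in `M`, so every `k(n) = o(n)` is defeated. -/

/-! ### Bijective back-and-forth for counting logic -/

namespace CountFormula

variable {L : FirstOrder.Language.{0, 0}} {k : ℕ} {A B : Type} [L.Structure A] [L.Structure B]

/-- A back-and-forth system of bijections preserves the truth of counting formulas. -/
theorem realize_iff_of_backForth (R : (Fin k → A) → (Fin k → B) → Prop)
    (heq : ∀ v w, R v w → ∀ x y, v x = v y ↔ w x = w y)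
    (hrel : ∀ v w, R v w → ∀ {r : ℕ} (S : L.Relations r) (x : Fin r → Fin k),
      FirstOrder.Language.Structure.RelMap S (fun j => v (x j)) ↔
        FirstOrder.Language.Structure.RelMap S (fun j => w (x j)))
    (hext : ∀ v w, R v w → ∀ x, ∃ e : A ≃ B, ∀ a,
      R (Function.update v x a) (Function.update w x (e a)))
    (φ : CountFormula L k) : ∀ v w, R v w → (φ.Realize v ↔ φ.Realize w) := by
  induction φ with
  | falsum => exact fun _ _ _ => Iff.rfl
  | equal x y => exact fun v w h => heq v w h x y
  | rel S x => exact fun v w h => hrel v w h S x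
  | neg φ ih => exact fun v w h => not_congr (ih v w h)
  | conj φ ψ ih₁ ih₂ => exact fun v w h => and_congr (ih₁ v w h) (ih₂ v w h)
  | exGe i x φ ih =>
    intro v w h
    obtain ⟨e, he⟩ := hext v w h x
    have : {b : B | φ.Realize (Function.update w x b)} =
        e '' {a : A | φ.Realize (Function.update v x a)} := by
      ext b
      rw [Equiv.image_eq_preimage_symm]
      have := ih _ _ (he (e.symm b))
      simpa using this.symm
    simp only [Realize, this, e.injective.encard_image]

end CountFormula

namespace ThreeXor

variable {V C : Type} [Fintype C] [DecidableEq V]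

/-! ### Local consistency of expanding linear systems -/

/-- The left-hand side of the linear combination with coefficients `a` of the equations
`∑ i, var c i = b c`. -/
def combination (var : C → Fin 3 → V) (a : C → ZMod 2) (x : V) : ZMod 2 :=
  ∑ c, a c * ∑ i, if var c i = x then 1 else 0

variable {var : C → Fin 3 → V}

theorem combination_add (a a' : C → ZMod 2) (x : V) :
    combination var (a + a') x = combination var a x + combination var a' x := by
  simp [combination, add_mul, Finset.sum_add_distrib]

theorem combination_single [DecidableEq C] (c : C) (x : V) :
    combination var (Pi.single c 1) x = ∑ i, if var c i = x then 1 else 0 := by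
  simp [combination, Pi.single_apply]

theorem hammingNorm_single_one [DecidableEq C] (c : C) :
    hammingNorm (Pi.single c 1 : C → ZMod 2) = 1 := by
  simp [hammingNorm, Pi.single_apply, Finset.filter_eq']

theorem hammingNorm_add_le (a a' : C → ZMod 2) :
    hammingNorm (a + a') ≤ hammingNorm a + hammingNorm a' := by
  classical
  unfold hammingNorm
  refine (Finset.card_le_card fun c => ?_).trans (Finset.card_union_le _ _)
  simp only [Finset.mem_filter, Finset.mem_union, Finset.mem_univ, true_and, Pi.add_apply]
  contrapose!
  rintro ⟨h₁, h₂⟩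
  simp [h₁, h₂]

variable [Fintype V]

/-- A combination of at most `2 * s` equations involves more than half as many variables
as equations. -/
def Expands (var : C → Fin 3 → V) (s : ℕ) : Prop :=
  ∀ a : C → ZMod 2, a ≠ 0 → hammingNorm a ≤ 2 * s →
    hammingNorm a < 2 * hammingNorm (combination var a)

/-- On the variables in `D`, the assignment `h` satisfies all equations that are combinations of at
most `s` of the given ones. -/
def LocallyConsistent (var : C → Fin 3 → V) (b : C → ZMod 2) (s : ℕ) (D : Finset V)
    (h : V → ZMod 2) : Prop :=
  ∀ a : C → ZMod 2, hammingNorm a ≤ s → (∀ x, combination var a x ≠ 0 → x ∈ D) →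
    ∑ x, combination var a x * h x = ∑ c, a c * b c

variable {b : C → ZMod 2} {s : ℕ} {D : Finset V} {h : V → ZMod 2}

theorem LocallyConsistent.mono {D' : Finset V} (hD : LocallyConsistent var b s D h)
    (hsub : D' ⊆ D) : LocallyConsistent var b s D' h :=
  fun a ha hx => hD a ha fun x hne => hsub (hx x hne)

theorem LocallyConsistent.sum_eq (hD : LocallyConsistent var b s D h) (hs : 1 ≤ s) {c : C}
    (hc : ∀ i, var c i ∈ D) : ∑ i, h (var c i) = b c := by
  classical
  have := hD (Pi.single c 1) (by rwa [hammingNorm_single_one]) (fun x hx => by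
    rw [combination_single] at hx
    obtain ⟨i, -, hi⟩ := Finset.exists_ne_zero_of_sum_ne_zero hx
    have : var c i = x := by by_contra hne; simp [hne] at hi
    exact this ▸ hc i)
  simp only [combination_single, Finset.sum_mul, Pi.single_apply] at this
  rw [Finset.sum_comm] at this
  simpa using this

/-- Expansion leaves no nontrivial short linear dependency, so the only condition on the empty set
is 0 = 0. -/
theorem Expands.locallyConsistent_empty (hE : Expands var s) :
    LocallyConsistent var b s ∅ h := by
  intro a ha hx
  have h0 : combination var a = 0 := by
    funext x
    by_contra hne
    simpa using hx x hne
  have : a = 0 := by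
    by_contra hne
    have := hE a hne (by omega)
    simp [h0] at this
  subst this
  simp [h0]

/-- Two equations with the same variables would sum to a vanishing combination of weight 2. -/
theorem Expands.injective (hE : Expands var s) (hs : 1 ≤ s) : Function.Injective var := by
  classical
  intro c c' hcc
  by_contra hne
  have hsum : combination var (Pi.single c 1 + Pi.single c' 1) = 0 := by
    funext x
    rw [combination_add, combination_single, combination_single, hcc]
    exact CharTwo.add_self_eq_zero _
  have := hE (Pi.single c 1 + Pi.single c' 1)
    (fun h0 => by simpa [Pi.single_apply, hne] using congrFun h0 c)
    ((hammingNorm_add_le _ _).trans (by simp only [hammingNorm_single_one]; omega))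
  simp [hsum] at this

/-- If `h` violates some short combination `a₀` on the larger set, flip it at `z`. Any other short
combination through `z` then holds too: its sum with `a₀` has no `z`, hence lives on `D`, and
expansion makes that sum short enough for consistency on `D` to apply. -/
theorem Expands.exists_insert (hE : Expands var s) (hD : LocallyConsistent var b s D h)
    (hcard : 2 * D.card ≤ s) (z : V) :
    ∃ h', (∀ x ∈ D, h' x = h x) ∧ LocallyConsistent var b s (insert z D) h' := by
  by_cases hz : z ∈ D
  · exact ⟨h, fun _ _ => rfl, by rwa [Finset.insert_eq_of_mem hz]⟩
  by_cases hgood : LocallyConsistent var b s (insert z D) h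
  · exact ⟨h, fun _ _ => rfl, hgood⟩
  unfold LocallyConsistent at hgood
  push Not at hgood
  obtain ⟨a₀, ha₀, hx₀, hne₀⟩ := hgood
  have two : ∀ u : ZMod 2, u ≠ 0 → u = 1 := by decide
  have hz₀ : combination var a₀ z = 1 := by
    refine two _ fun h0 => hne₀ (hD a₀ ha₀ fun x hx => ?_)
    exact (Finset.mem_insert.1 (hx₀ x hx)).resolve_left (by rintro rfl; exact hx h0)
  refine ⟨h + Pi.single z 1, fun x hx => ?_, fun a ha hx => ?_⟩
  · have : x ≠ z := by rintro rfl; exact hz hx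
    simp [this]
  have hsum : ∑ x, combination var a x * (h + Pi.single z 1 : V → ZMod 2) x =
      ∑ x, combination var a x * h x + combination var a z := by
    simp [mul_add, Finset.sum_add_distrib, Pi.single_apply]
  rw [hsum]
  by_cases hza : combination var a z = 0
  · rw [hza, add_zero]
    exact hD a ha fun x hne =>
      (Finset.mem_insert.1 (hx x hne)).resolve_left (by rintro rfl; exact hne hza)
  have hza' := two _ hza
  have hsupp : ∀ x, combination var (a + a₀) x ≠ 0 → x ∈ D := by
    intro x hne
    by_cases hxz : x = z
    · subst hxz
      rw [combination_add, hza', hz₀] at hne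
      exact absurd (by decide) hne
    by_contra hxD
    have h1 : combination var a x = 0 := by
      by_contra h1
      exact (Finset.mem_insert.1 (hx x h1)).elim hxz hxD
    have h2 : combination var a₀ x = 0 := by
      by_contra h2
      exact (Finset.mem_insert.1 (hx₀ x h2)).elim hxz hxD
    rw [combination_add, h1, h2] at hne
    simp at hne
  have hnorm : hammingNorm (combination var (a + a₀)) ≤ D.card :=
    Finset.card_le_card fun x hx => hsupp x (by simpa using hx)
  -- A priori the weight is only at most `2 * s`, which is why `Expands` reaches that far; expansion
  -- brings it below `2 * D.card ≤ s`.
  have hlow : hammingNorm (a + a₀) ≤ s := by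
    by_cases h0 : a + a₀ = 0
    · simp [h0]
    have := hE _ h0 ((hammingNorm_add_le _ _).trans (by omega))
    omega
  have key := hD _ hlow hsupp
  simp only [combination_add, Pi.add_apply, add_mul, Finset.sum_add_distrib] at key
  rw [hza']
  have arith : ∀ p p₀ q q₀ : ZMod 2, p₀ ≠ q₀ → p + p₀ = q + q₀ → p + 1 = q := by decide
  exact arith _ _ _ _ hne₀ key

theorem Expands.exists_union (hE : Expands var s) (hD : LocallyConsistent var b s D h)
    (S : Finset V) (hcard : 2 * (D.card + S.card) ≤ s) :
    ∃ h', (∀ x ∈ D, h' x = h x) ∧ LocallyConsistent var b s (D ∪ S) h' := by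
  induction S using Finset.induction_on with
  | empty => exact ⟨h, fun _ _ => rfl, by simpa using hD⟩
  | insert z S hz ih =>
    rw [Finset.card_insert_of_notMem hz] at hcard
    obtain ⟨h₁, hh₁, hD₁⟩ := ih (by omega)
    obtain ⟨h₂, hh₂, hD₂⟩ := hE.exists_insert hD₁
      (by have := Finset.card_union_le D S; omega) z
    refine ⟨h₂, fun x hx => (hh₂ x (Finset.mem_union_left _ hx)).trans (hh₁ x hx), ?_⟩
    rwa [Finset.union_insert]

/-! ### Structures whose elements are twisted by an assignment -/

/-- If twisting the elements of `A` by locally consistent assignments preserves relations, then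
`A` is equivalent to the twisted structure in counting logic. -/
theorem Expands.countEquiv (hE : Expands var s) {L : FirstOrder.Language.{0, 0}} [L.IsRelational]
    {k : ℕ} {A B : Type} [L.Structure A] [L.Structure B] (hk : 6 * k ≤ s)
    (suppA : A → Finset V) (suppB : B → Finset V) (hcard : ∀ a, (suppA a).card ≤ 3)
    (twist : (V → ZMod 2) → A → B) (hbij : ∀ h, Function.Bijective (twist h))
    (hsupp : ∀ h a, suppB (twist h a) = suppA a)
    (hcongr : ∀ h h' a, (∀ x ∈ suppA a, h x = h' x) → twist h a = twist h' a)
    (hrel : ∀ h {r : ℕ} (R : L.Relations r) (v : Fin r → A),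
      (∃ D, LocallyConsistent var b s D h ∧ ∀ j, suppA (v j) ⊆ D) →
      (FirstOrder.Language.Structure.RelMap R v ↔
        FirstOrder.Language.Structure.RelMap R (fun j => twist h (v j)))) :
    CountEquiv L k A B := by
  classical
  have hle : ∀ (J : Finset (Fin k)) (v : Fin k → A),
      (J.biUnion fun j => suppA (v j)).card ≤ 3 * J.card := fun J v => by
    rw [mul_comm]
    exact Finset.card_biUnion_le_card_mul _ _ _ fun j _ => hcard (v j)
  have main := fun φ : CountFormula L k => φ.realize_iff_of_backForth (A := A) (B := B)
    (fun v w => ∃ h, LocallyConsistent var b s (Finset.univ.biUnion fun j => suppA (v j)) h ∧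
      ∀ j, w j = twist h (v j)) ?_ ?_ ?_
  · have start : ∀ D : Finset V, D.card ≤ 3 * k → ∃ h, LocallyConsistent var b s D h := by
      intro D hD
      obtain ⟨h, -, hh⟩ := hE.exists_union (hE.locallyConsistent_empty (b := b) (h := 0)) D
        (by simp only [Finset.card_empty]; omega)
      exact ⟨h, by simpa using hh⟩
    have huniv := fun v => hle Finset.univ v
    simp only [Finset.card_univ, Fintype.card_fin] at huniv
    intro φ _
    constructor
    · intro hA w
      -- Supports do not depend on the twist, so the zero twist reveals which variables `h` must
      -- handle before `h` is chosen.
      obtain ⟨v₀, hv₀⟩ : ∃ v₀ : Fin k → A, ∀ j, twist 0 (v₀ j) = w j :=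
        ⟨fun j => (hbij 0).2 (w j) |>.choose, fun j => ((hbij 0).2 (w j)).choose_spec⟩
      obtain ⟨h, hh⟩ := start _ (huniv v₀)
      choose v hv using fun j => (hbij h).2 (w j)
      refine (main φ v w ⟨h, ?_, fun j => (hv j).symm⟩).1 (hA v)
      have : ∀ j, suppA (v j) = suppA (v₀ j) := fun j => by
        rw [← hsupp h, ← hsupp 0, hv, hv₀]
      simpa only [this] using hh
    · intro hB v
      obtain ⟨h, hh⟩ := start _ (huniv v)
      exact (main φ v _ ⟨h, hh, fun _ => rfl⟩).2 (hB _)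
  · rintro v w ⟨h, -, hw⟩ x y
    rw [hw, hw, (hbij h).1.eq_iff]
  · rintro v w ⟨h, hh, hw⟩ r R x
    simp only [hw]
    exact hrel h R _ ⟨_, hh, fun j => Finset.subset_biUnion_of_mem (fun j => suppA (v j))
      (Finset.mem_univ (x j))⟩
  · rintro v w ⟨h, hh, hw⟩ x
    set D := (Finset.univ.erase x).biUnion fun j => suppA (v j) with hDdef
    have hD : LocallyConsistent var b s D h :=
      hh.mono (Finset.biUnion_subset_biUnion_of_subset_left _ (Finset.erase_subset _ _))
    have hDcard : D.card + 3 ≤ 3 * k := by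
      have h1 := hle (Finset.univ.erase x) v
      have h2 := Finset.card_erase_add_one (Finset.mem_univ x)
      rw [← hDdef] at h1
      rw [Finset.card_univ, Fintype.card_fin] at h2
      omega
    -- The extension is chosen per support, not per element: elements with equal support get the
    -- same twist, which makes the combined map bijective. The value for larger `S` is a dummy.
    have hex : ∀ S : Finset V, ∃ h', S.card ≤ 3 →
        (∀ x ∈ D, h' x = h x) ∧ LocallyConsistent var b s (D ∪ S) h' := by
      intro S
      by_cases hS : S.card ≤ 3
      · obtain ⟨h', hh'⟩ := hE.exists_union hD S (by omega)
        exact ⟨h', fun _ => hh'⟩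
      · exact ⟨h, fun hS' => absurd hS' hS⟩
    choose g hg using hex
    have hbij' : Function.Bijective fun a => twist (g (suppA a)) a := by
      constructor
      · intro a a' haa
        have hs : suppA a = suppA a' := by
          rw [← hsupp (g (suppA a)) a, ← hsupp (g (suppA a')) a']
          exact congrArg suppB haa
        dsimp only at haa
        rw [hs] at haa
        exact (hbij _).1 haa
      · intro b'
        obtain ⟨a, ha⟩ := (hbij (g (suppB b'))).2 b'
        have hs : suppA a = suppB b' := by rw [← hsupp (g (suppB b')) a, ha]
        exact ⟨a, by dsimp only; rw [hs, ha]⟩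
    refine ⟨Equiv.ofBijective _ hbij', fun a => ⟨g (suppA a), ?_, fun j => ?_⟩⟩
    · refine (hg _ (hcard a)).2.mono (Finset.biUnion_subset.2 fun j _ => ?_)
      by_cases hj : j = x
      · subst hj
        simp
      · rw [Function.update_of_ne hj]
        exact (Finset.subset_biUnion_of_mem (fun j => suppA (v j))
          (Finset.mem_erase.2 ⟨hj, Finset.mem_univ j⟩)).trans Finset.subset_union_left
    · by_cases hj : j = x
      · subst hj
        simp
      · rw [Function.update_of_ne hj, Function.update_of_ne hj, hw]
        refine hcongr _ _ _ fun y hy => ((hg _ (hcard a)).1 y ?_).symm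
        exact Finset.mem_biUnion.2 ⟨j, Finset.mem_erase.2 ⟨hj, Finset.mem_univ j⟩, hy⟩

/-! ### Doubling the variables -/

/-- Each variable `x` is replaced by two variables `(x, 0)` and `(x, 1)`, which stand for `x` and
`x + 1`, and each equation by the eight equations that follow from it. -/
def doubling (var : C → Fin 3 → V) (hvar : ∀ c, Function.Injective (var c)) (b : C → ZMod 2) :
    ThreeXor where
  Var := V × ZMod 2
  Con := C × (Fin 3 → ZMod 2)
  var p i := (var p.1 i, p.2 i)
  var_injective p _ _ hij := hvar p.1 (Prod.ext_iff.1 hij).1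
  rhs p := b p.1 + ∑ i, p.2 i

variable {hvar : ∀ c, Function.Injective (var c)}

omit [DecidableEq V] in
theorem doubling_zero_satisfiable : (doubling var hvar 0).Satisfiable := by
  refine ⟨fun p : V × ZMod 2 => p.2, fun c => ?_⟩
  simp [Satisfies, doubling, Fin.sum_univ_three]

theorem Expands.doubling_noRepeat (hE : Expands var s) (hs : 1 ≤ s) :
    (doubling var hvar b).NoRepeat := by
  rintro ⟨c, p⟩ ⟨c', p'⟩ h
  have h1 : (fun i => (var c i, p i)) = fun i => (var c' i, p' i) := (Prod.ext_iff.1 h).1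
  refine Prod.ext (hE.injective hs (funext fun i => ?_)) (funext fun i => ?_)
  · exact (Prod.ext_iff.1 (congrFun h1 i)).1
  · exact (Prod.ext_iff.1 (congrFun h1 i)).2

/-- The permutation of the doubled variables that interchanges `(x, 0)` and `(x, 1)` where
`h x = 1`. -/
def twistVar (h : V → ZMod 2) : V × ZMod 2 ≃ V × ZMod 2 where
  toFun p := (p.1, p.2 + h p.1)
  invFun p := (p.1, p.2 - h p.1)
  left_inv p := by simp
  right_inv p := by simp

/-- The permutation of the constraints induced by `twistVar`. -/
def twistCon (var : C → Fin 3 → V) (h : V → ZMod 2) :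
    C × (Fin 3 → ZMod 2) ≃ C × (Fin 3 → ZMod 2) where
  toFun p := (p.1, fun i => p.2 i + h (var p.1 i))
  invFun p := (p.1, fun i => p.2 i - h (var p.1 i))
  left_inv p := by simp
  right_inv p := by simp

/-- Twisting adds the sum of `h` over the equation to the right-hand side, and this sum is `b p.1`.
-/
theorem doubling_rhs_twistCon (hD : LocallyConsistent var b s D h) (hs : 1 ≤ s)
    (p : C × (Fin 3 → ZMod 2)) (hp : ∀ i, var p.1 i ∈ D) :
    (doubling var hvar 0).rhs (twistCon var h p) = (doubling var hvar b).rhs p := by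
  simp only [doubling, twistCon, Equiv.coe_fn_mk, Finset.sum_add_distrib, hD.sum_eq hs hp,
    Pi.zero_apply]
  ring

theorem Expands.countEquiv_varLang (hE : Expands var s) (hs : 1 ≤ s) {k : ℕ} (hk : 6 * k ≤ s) :
    CountEquiv varLang k (doubling var hvar b).Var (doubling var hvar 0).Var := by
  refine hE.countEquiv (b := b) hk (fun p : V × ZMod 2 => {p.1}) (fun p : V × ZMod 2 => {p.1})
    (by simp) (fun h => twistVar h) (fun h => (twistVar h).bijective) (fun _ _ => rfl) ?_ ?_
  · intro h h' a hh
    exact Prod.ext rfl (congrArg (a.2 + ·) (hh a.1 (Finset.mem_singleton_self _)))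
  · rintro h _ ⟨β⟩ v ⟨D, hD, hv⟩
    have hv' : ∀ j, (v j).1 ∈ D := fun j => hv j (by simp)
    constructor
    · rintro ⟨p, rfl, hr⟩
      exact ⟨twistCon var h p, rfl, (doubling_rhs_twistCon hD hs p hv').trans hr⟩
    · rintro ⟨q, hvq, hr⟩
      obtain ⟨p, rfl⟩ := (twistCon var h).surjective q
      have hvp : v = (doubling var hvar b).var p :=
        funext fun j => (twistVar h).injective (congrFun hvq j)
      subst hvp
      exact ⟨p, rfl, (doubling_rhs_twistCon hD hs p hv').symm.trans hr⟩

theorem Expands.countEquiv_incLang (hE : Expands var s) (hs : 1 ≤ s) {k : ℕ} (hk : 6 * k ≤ s) :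
    CountEquiv incLang k ((doubling var hvar b).Var ⊕ (doubling var hvar b).Con)
      ((doubling var hvar 0).Var ⊕ (doubling var hvar 0).Con) := by
  let supp : (V × ZMod 2) ⊕ (C × (Fin 3 → ZMod 2)) → Finset V :=
    Sum.elim (fun p => {p.1}) (fun p => Finset.univ.image (var p.1))
  have hsupp : ∀ (p : C × (Fin 3 → ZMod 2)) i, var p.1 i ∈ supp (Sum.inr p) :=
    fun p i => Finset.mem_image_of_mem _ (Finset.mem_univ i)
  refine hE.countEquiv (b := b) hk supp supp ?_
    (fun h => Equiv.sumCongr (twistVar h) (twistCon var h)) (fun h => Equiv.bijective _) ?_ ?_ ?_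
  · rintro (p | p)
    · exact (Finset.card_singleton p.1).trans_le (by norm_num)
    · exact Finset.card_image_le
  · rintro h (p | p) <;> rfl
  · rintro h h' (p | p) hh
    · exact congrArg Sum.inl (Prod.ext rfl (congrArg (p.2 + ·)
        (hh p.1 (Finset.mem_singleton_self _))))
    · exact congrArg Sum.inr (Prod.ext rfl (funext fun i =>
        congrArg (p.2 i + ·) (hh (var p.1 i) (hsupp p i))))
  · rintro h _ R v ⟨D, hD, hv⟩
    have inj := (Equiv.sumCongr (twistVar h) (twistCon var h)).injective
    cases R with
    | E i =>
      constructor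
      · rintro ⟨p, h0, h1⟩
        exact ⟨twistCon var h p, congrArg (Equiv.sumCongr (twistVar h) (twistCon var h)) h0,
          congrArg (Equiv.sumCongr (twistVar h) (twistCon var h)) h1⟩
      · rintro ⟨q, h0, h1⟩
        obtain ⟨p, rfl⟩ := (twistCon var h).surjective q
        exact ⟨p, inj h0, inj h1⟩
    | Z β =>
      constructor
      · rintro ⟨p, h0, hr⟩
        refine ⟨twistCon var h p, congrArg (Equiv.sumCongr (twistVar h) (twistCon var h)) h0,
          (doubling_rhs_twistCon hD hs p fun i => hv 0 ?_).trans hr⟩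
        rw [h0]
        exact hsupp p i
      · rintro ⟨q, h0, hr⟩
        obtain ⟨p, rfl⟩ := (twistCon var h).surjective q
        have h0' : v 0 = Sum.inr p := inj h0
        refine ⟨p, h0', (doubling_rhs_twistCon hD hs p fun i => hv 0 ?_).symm.trans hr⟩
        rw [h0']
        exact hsupp p i

end ThreeXor

namespace ThreeXor

/-! ### Random right-hand sides -/

/-- The nontrivial character of `ZMod 2`. -/
def sign (u : ZMod 2) : ℝ := if u = 0 then 1 else -1

theorem sign_add (u v : ZMod 2) : sign (u + v) = sign u * sign v := by
  have h : ∀ u v : ZMod 2, (u + v = 0) ↔ (u = 0 ↔ v = 0) := by decide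
  by_cases hu : u = 0 <;> by_cases hv : v = 0 <;> simp [sign, h, hu, hv]

theorem abs_sign (u : ZMod 2) : |sign u| = 1 := by
  unfold sign
  split_ifs <;> simp

/-- Hoeffding's estimate for one random sign, from cosh u ≤ exp(u²/2). -/
theorem sum_exp_mul_sign_le (t w K : ℝ) (hw : |w| ≤ K) :
    ∑ β : ZMod 2, Real.exp (t * (sign β * w)) ≤ 2 * Real.exp (t ^ 2 * K ^ 2 / 2) := by
  have h : ∑ β : ZMod 2, Real.exp (t * (sign β * w)) = 2 * Real.cosh (t * w) := by
    have huniv : (Finset.univ : Finset (ZMod 2)) = {0, 1} := by decide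
    rw [huniv, Finset.sum_pair zero_ne_one, sign, sign, if_pos rfl, if_neg one_ne_zero,
      Real.cosh_eq]
    ring_nf
  rw [h]
  have hK := sq_le_sq' (neg_le_of_abs_le hw) (le_of_abs_le hw)
  refine mul_le_mul_of_nonneg_left ((Real.cosh_le_exp_half_sq _).trans ?_) zero_le_two
  rw [mul_pow]
  gcongr

theorem card_satisfies_eq (I : ThreeXor) (f : I.Var → ZMod 2) :
    (Nat.card {c : I.Con // I.Satisfies f c} : ℝ) =
      ∑ c, (1 + sign (f (I.var c 0) + f (I.var c 1) + f (I.var c 2) + I.rhs c)) / 2 := by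
  classical
  rw [Nat.card_eq_fintype_card, Fintype.card_subtype, Finset.card_filter, Nat.cast_sum]
  refine Finset.sum_congr rfl fun c _ => ?_
  have h : ∀ u v : ZMod 2, u + v = 0 ↔ u = v := by decide
  by_cases hc : I.Satisfies f c
  · rw [if_pos hc, sign, if_pos ((h _ _).2 hc)]
    norm_num
  · rw [if_neg hc, sign, if_neg fun h0 => hc ((h _ _).1 h0)]
    norm_num

variable {V C : Type} [Fintype V] [Fintype C]

/-- For fixed `f`, the excess of satisfied over violated constraints is a sum of independent terms
`sign (b c) * w f c` bounded by 8, so Hoeffding beats a union bound over the `4 ^ card V`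
assignments of the doubled variables. -/
theorem exists_not_fracSatisfiable_doubling (var : C → Fin 3 → V)
    (hvar : ∀ c, Function.Injective (var c)) {ε : ℝ}
    (hC : (Fintype.card V : ℝ) < ε ^ 2 * Fintype.card C) (hε : 0 < ε) :
    ∃ b, ¬ (doubling var hvar b).FracSatisfiable (1 / 2 + ε) := by
  classical
  by_contra! hall
  set m := Fintype.card C with hm
  set w : (V × ZMod 2 → ZMod 2) → C → ℝ := fun f c => ∑ p : Fin 3 → ZMod 2,
    sign (f (var c 0, p 0) + f (var c 1, p 1) + f (var c 2, p 2) + ∑ i, p i) with hw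
  have hw8 : ∀ f c, |w f c| ≤ 8 := by
    intro f c
    refine (Finset.abs_sum_le_sum_abs _ _).trans ?_
    simp only [abs_sign]
    simp
  have hbad : ∀ b : C → ZMod 2, ∃ f, 16 * ε * m ≤ ∑ c, sign (b c) * w f c := by
    intro b
    obtain ⟨f, hf⟩ := hall b
    refine ⟨f, ?_⟩
    rw [card_satisfies_eq] at hf
    have h1 : (Nat.card (doubling var hvar b).Con : ℝ) = 8 * m := by
      change (Nat.card (C × (Fin 3 → ZMod 2)) : ℝ) = 8 * m
      rw [Nat.card_eq_fintype_card, Fintype.card_prod, ← hm]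
      simp
      ring
    have h2 : ∑ c, (1 + sign (f ((doubling var hvar b).var c 0) + f ((doubling var hvar b).var c 1) +
        f ((doubling var hvar b).var c 2) + (doubling var hvar b).rhs c)) / 2 =
        4 * m + (∑ c, sign (b c) * w f c) / 2 := by
      change ∑ c : C × (Fin 3 → ZMod 2), (1 + sign (f (var c.1 0, c.2 0) + f (var c.1 1, c.2 1) +
        f (var c.1 2, c.2 2) + (b c.1 + ∑ i, c.2 i))) / 2 = _
      rw [← Finset.sum_div, Finset.sum_add_distrib, add_div]
      congr 1
      · simp [← hm]
        ring
      · congr 1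
        rw [Fintype.sum_prod_type]
        refine Finset.sum_congr rfl fun c _ => ?_
        rw [hw, Finset.mul_sum]
        refine Finset.sum_congr rfl fun p _ => ?_
        rw [← sign_add]
        congr 1
        ring
    rw [h1, h2] at hf
    linarith
  -- This minimises the exponent `32 * t ^ 2 - 16 * ε * t`.
  set t := ε / 4 with ht
  have hexp : ∀ f, ∑ b : C → ZMod 2, Real.exp (t * ∑ c, sign (b c) * w f c) ≤
      (2 * Real.exp (t ^ 2 * 8 ^ 2 / 2)) ^ m := by
    intro f
    have : ∀ b : C → ZMod 2, Real.exp (t * ∑ c, sign (b c) * w f c) =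
        ∏ c, Real.exp (t * (sign (b c) * w f c)) := fun b => by
      rw [Finset.mul_sum, Real.exp_sum]
    simp only [this]
    rw [← Fintype.piFinset_univ,
      ← Finset.prod_univ_sum (fun _ : C => Finset.univ)
        (fun c β => Real.exp (t * (sign β * w f c)))]
    refine (Finset.prod_le_prod (fun c _ => Finset.sum_nonneg fun _ _ => (Real.exp_pos _).le)
      fun c _ => sum_exp_mul_sign_le t _ 8 (hw8 f c)).trans_eq ?_
    simp [hm]
  have hone : ∀ b : C → ZMod 2, Real.exp (t * (16 * ε * m)) ≤
      ∑ f, Real.exp (t * ∑ c, sign (b c) * w f c) := by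
    intro b
    obtain ⟨f, hf⟩ := hbad b
    refine le_trans ?_ (Finset.single_le_sum (f := fun f => Real.exp (t * ∑ c, sign (b c) * w f c))
      (fun _ _ => (Real.exp_pos _).le) (Finset.mem_univ f))
    exact Real.exp_le_exp.2 (mul_le_mul_of_nonneg_left hf (by positivity))
  have htotal := Finset.sum_le_sum fun b (_ : b ∈ (Finset.univ : Finset (C → ZMod 2))) => hone b
  rw [Finset.sum_comm] at htotal
  have htotal := htotal.trans (Finset.sum_le_sum fun f _ => hexp f)
  simp only [Finset.sum_const, nsmul_eq_mul, Finset.card_univ, Fintype.card_fun, ZMod.card,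
    Fintype.card_prod, Nat.cast_pow, Nat.cast_ofNat, ← hm, mul_pow] at htotal
  rw [mul_left_comm ((2 : ℝ) ^ (Fintype.card V * 2)), mul_le_mul_iff_right₀ (by positivity),
    ← Real.exp_nat_mul, pow_mul'] at htotal
  have h4 : ((2 : ℝ) ^ 2) ^ Fintype.card V ≤ Real.exp (2 * Fintype.card V) := by
    rw [mul_comm, Real.exp_nat_mul]
    gcongr
    have : (2 : ℝ) ≤ Real.exp 1 := by linarith [Real.add_one_le_exp (1 : ℝ)]
    calc (2 : ℝ) ^ 2 ≤ Real.exp 1 ^ 2 := by gcongr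
      _ = Real.exp 2 := by rw [← Real.exp_nat_mul]; norm_num
  have h5 := htotal.trans (mul_le_mul_of_nonneg_right (by simpa using h4) (Real.exp_pos _).le)
  rw [← Real.exp_add, Real.exp_le_exp] at h5
  rw [ht] at h5
  nlinarith

end ThreeXor

/-! ### Existence of expanding systems -/

/-- The `q`-element sets among `3 * M` points, the `t`-element sets among `c * M` equations and the
probability that all variables of the latter lie in the former multiply to at most `2⁻ᵗ`. -/
theorem choose_mul_choose_mul_pow_le {c M t q : ℕ} {y : ℝ} (hy0 : 0 < y) (hy1 : y ≤ 1)
    (hy : 36 * c * Real.exp 1 ^ 3 * y ≤ 1) (ht : 1 ≤ t) (htM : 2 * (t : ℝ) ≤ y ^ 4 * M)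
    (hq0 : 1 ≤ q) (hq : 4 * q ≤ 7 * t) :
    ((c * M).choose t : ℝ) * ((3 * M).choose q : ℝ) * ((q : ℝ) ^ 3) ^ t ≤
      (1 / 2) ^ t * ((M : ℝ) ^ 3) ^ t := by
  set e := Real.exp 1 with he
  have he1 : 1 ≤ e := Real.one_le_exp zero_le_one
  have ht' : (1 : ℝ) ≤ t := by exact_mod_cast ht
  have hq' : (1 : ℝ) ≤ q := by exact_mod_cast hq0
  have hqt : (q : ℝ) ≤ 2 * t := by
    have : q ≤ 2 * t := by omega
    exact_mod_cast this
  have hM : (0 : ℝ) < M := by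
    by_contra hM
    have : y ^ 4 * M ≤ 0 := mul_nonpos_of_nonneg_of_nonpos (by positivity) (not_lt.1 hM)
    linarith
  have hchoose : ∀ n r : ℕ, (1 : ℝ) ≤ r → (n.choose r : ℝ) ≤ (n * e / r) ^ r := by
    intro n r hr
    refine (Nat.choose_le_pow_div r n).trans ?_
    have h1 := Real.pow_div_factorial_le_exp r r.cast_nonneg r
    have h2 : Real.exp (r : ℝ) = e ^ r := by rw [he, ← Real.exp_nat_mul, mul_one]
    rw [h2, div_le_iff₀ (by positivity)] at h1
    rw [div_pow, mul_pow, div_le_div_iff₀ (by positivity) (by positivity), mul_assoc]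
    exact mul_le_mul_of_nonneg_left h1 (by positivity)
  have h1 := hchoose (c * M) t ht'
  have h2 := hchoose (3 * M) q hq'
  push_cast at h1 h2
  set w : ℝ := 2 * t / M with hw
  have hwy : w ≤ y ^ 4 := by rwa [hw, div_le_iff₀ hM]
  have hw0 : 0 < w := by positivity
  -- One factor `w ^ t` cancels the `M / t` of the first binomial. The remaining exponent `2 * t -
  -- q` is at least `t / 4`, so the fourth power in `w ≤ y ^ 4` leaves a gain of `y ^ t`.
  have hz : ((q : ℝ) / M) ^ (3 * t - q) ≤ (w * y) ^ t := by
    have hqw : (q : ℝ) / M ≤ w := by rw [hw]; gcongr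
    have hsplit : 3 * t - q = t + (2 * t - q) := by omega
    calc ((q : ℝ) / M) ^ (3 * t - q) ≤ w ^ (3 * t - q) := by gcongr
      _ = w ^ t * w ^ (2 * t - q) := by rw [hsplit, pow_add]
      _ ≤ w ^ t * (y ^ 4) ^ (2 * t - q) := by gcongr
      _ ≤ w ^ t * y ^ t := by
        rw [← pow_mul]
        refine mul_le_mul_of_nonneg_left (pow_le_pow_of_le_one hy0.le hy1 (by omega)) (by positivity)
      _ = (w * y) ^ t := (mul_pow _ _ _).symm
  have h3 : (3 * M * e / q : ℝ) ^ q * ((q : ℝ) ^ 3) ^ t =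
      (3 * e) ^ q * ((q : ℝ) / M) ^ (3 * t - q) * ((M : ℝ) ^ 3) ^ t := by
    have hsplit : 3 * t = q + (3 * t - q) := by omega
    have h4 : ((M : ℝ) ^ 3) ^ t = M ^ q * M ^ (3 * t - q) := by
      rw [← pow_mul, ← pow_add, ← hsplit]
    have h5 : ((q : ℝ) ^ 3) ^ t = q ^ q * q ^ (3 * t - q) := by
      rw [← pow_mul, ← pow_add, ← hsplit]
    rw [h4, h5, div_pow, div_pow, mul_pow, mul_pow, mul_pow]
    field_simp
  have h6 : (3 * e) ^ q ≤ ((3 * e) ^ 2) ^ t := by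
    rw [← pow_mul]
    exact pow_le_pow_right₀ (by linarith) (by omega)
  calc ((c * M).choose t : ℝ) * ((3 * M).choose q : ℝ) * ((q : ℝ) ^ 3) ^ t
      ≤ (c * M * e / t) ^ t * (3 * M * e / q) ^ q * ((q : ℝ) ^ 3) ^ t := by gcongr
    _ = (c * M * e / t) ^ t * ((3 * e) ^ q * ((q : ℝ) / M) ^ (3 * t - q)) *
        ((M : ℝ) ^ 3) ^ t := by rw [mul_assoc, h3]; ring
    _ ≤ (c * M * e / t) ^ t * (((3 * e) ^ 2) ^ t * (w * y) ^ t) * ((M : ℝ) ^ 3) ^ t := by gcongr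
    _ = (18 * c * e ^ 3 * y) ^ t * ((M : ℝ) ^ 3) ^ t := by
      rw [← mul_pow, ← mul_pow]
      congr 2
      rw [hw]
      field_simp
      ring
    _ ≤ (1 / 2) ^ t * ((M : ℝ) ^ 3) ^ t := by
      gcongr
      linarith

namespace ThreeXor

variable {V C : Type} [Fintype V] [Fintype C] [DecidableEq V]

/-- The equations with nonzero coefficient in a combination involve few variables if the combination
does. -/
theorem two_mul_card_biUnion_le (var : C → Fin 3 → V) (a : C → ZMod 2) :
    2 * ((Finset.univ.filter fun c => a c ≠ 0).biUnion fun c => Finset.univ.image (var c)).card ≤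
      3 * hammingNorm a + hammingNorm (combination var a) := by
  classical
  set T := Finset.univ.filter fun c => a c ≠ 0 with hT
  set U := T.biUnion fun c => Finset.univ.image (var c) with hU
  set deg : V → ℕ := fun x => ∑ c ∈ T, ∑ i, if var c i = x then 1 else 0 with hdeg
  have hsum : ∑ x, deg x = 3 * hammingNorm a := by
    rw [hdeg, Finset.sum_comm]
    have : ∀ c ∈ T, ∑ x, ∑ i, (if var c i = x then 1 else 0) = 3 := fun c _ => by
      rw [Finset.sum_comm]
      simp
    rw [Finset.sum_congr rfl this, Finset.sum_const, smul_eq_mul, mul_comm]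
    rfl
  have two : ∀ u : ZMod 2, u ≠ 0 → u = 1 := by decide
  have hcomb : ∀ x, combination var a x = deg x := by
    intro x
    rw [hdeg, combination, Nat.cast_sum, hT, Finset.sum_filter]
    refine Finset.sum_congr rfl fun c _ => ?_
    by_cases hc : a c = 0
    · simp [hc]
    · simp [two _ hc]
  -- A variable that occurs exactly once cannot cancel.
  have hle : ∀ x ∈ U, 2 ≤ deg x + if combination var a x ≠ 0 then 1 else 0 := by
    intro x hx
    have hpos : deg x ≠ 0 := by
      simp only [hU, Finset.mem_biUnion, Finset.mem_image, Finset.mem_univ, true_and] at hx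
      obtain ⟨c, hc, i, hi⟩ := hx
      intro h0
      have h1 := Finset.sum_eq_zero_iff.1 (Finset.sum_eq_zero_iff.1 h0 c hc) i (Finset.mem_univ i)
      simp [hi] at h1
    by_cases h1 : deg x = 1
    · have : combination var a x ≠ 0 := by rw [hcomb, h1]; decide
      rw [if_pos this]
      omega
    · omega
  calc 2 * U.card = ∑ x ∈ U, 2 := by rw [Finset.sum_const, smul_eq_mul, mul_comm]
    _ ≤ ∑ x ∈ U, (deg x + if combination var a x ≠ 0 then 1 else 0) := Finset.sum_le_sum hle
    _ ≤ ∑ x, (deg x + if combination var a x ≠ 0 then 1 else 0) :=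
      Finset.sum_le_sum_of_subset (Finset.subset_univ _)
    _ = 3 * hammingNorm a + hammingNorm (combination var a) := by
      rw [Finset.sum_add_distrib, hsum, ← Finset.card_filter]
      rfl

/-- Equations whose `i`-th variable is an arbitrary element of the `i`-th part, for three disjoint
parts of size `M`. -/
def tripartite {M : ℕ} (f : C → Fin 3 → Fin M) (c : C) (i : Fin 3) : Fin 3 × Fin M :=
  (i, f c i)

omit [Fintype C] in
theorem tripartite_injective {M : ℕ} (f : C → Fin 3 → Fin M) (c : C) :
    Function.Injective (tripartite f c) :=
  fun _ _ hij => congrArg Prod.fst hij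

/-- Each of the `3 * T.card` constrained entries has at most `Q.card` values; all other entries are
free. -/
theorem card_filter_tripartite_le [DecidableEq C] {M : ℕ} (T : Finset C)
    (Q : Finset (Fin 3 × Fin M)) :
    (Finset.univ.filter fun f : C → Fin 3 → Fin M => ∀ c ∈ T, ∀ i, tripartite f c i ∈ Q).card ≤
      (Q.card ^ 3) ^ T.card * (M ^ 3) ^ (Fintype.card C - T.card) := by
  set S : C → Finset (Fin 3 → Fin M) := fun c =>
    if c ∈ T then Fintype.piFinset fun i => Finset.univ.filter fun x => (i, x) ∈ Q
    else Finset.univ with hS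
  have hsub : (Finset.univ.filter fun f : C → Fin 3 → Fin M =>
      ∀ c ∈ T, ∀ i, tripartite f c i ∈ Q) ⊆ Fintype.piFinset S := by
    intro f hf
    simp only [Finset.mem_filter, Finset.mem_univ, true_and] at hf
    rw [Fintype.mem_piFinset]
    intro c
    by_cases hc : c ∈ T
    · simp only [hS, if_pos hc, Fintype.mem_piFinset, Finset.mem_filter, Finset.mem_univ, true_and]
      exact hf c hc
    · simp [hS, if_neg hc]
  refine (Finset.card_le_card hsub).trans ?_
  have hSle : ∀ c, (S c).card ≤ if c ∈ T then Q.card ^ 3 else M ^ 3 := by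
    intro c
    by_cases hc : c ∈ T
    · simp only [hS, if_pos hc, Fintype.card_piFinset]
      refine (Finset.prod_le_pow_card _ _ Q.card fun i _ => ?_).trans_eq (by simp)
      refine Finset.card_le_card_of_injOn (fun x => (i, x)) (fun x hx => by simpa using hx) ?_
      exact fun x _ y _ hxy => congrArg Prod.snd hxy
    · simp [hS, if_neg hc]
  rw [Fintype.card_piFinset]
  refine (Finset.prod_le_prod' fun c _ => hSle c).trans_eq ?_
  rw [Finset.prod_ite, Finset.prod_const, Finset.prod_const, Finset.filter_not,
    Finset.card_sdiff_of_subset (Finset.filter_subset _ _)]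
  simp

/-- First-moment argument. A combination of weight `t` violating expansion has at most `t / 2`
surviving variables, so its `t` equations involve at most `(3 + 1/2) * t / 2 = 7 * t / 4` variables.
The union bound over `t`, the equations and the variable set costs less than the sum of `2⁻ᵗ`. -/
theorem exists_expands {c M s : ℕ} {y : ℝ} (hy0 : 0 < y) (hy1 : y ≤ 1)
    (hy : 36 * c * Real.exp 1 ^ 3 * y ≤ 1) (hs : 4 * (s : ℝ) ≤ y ^ 4 * M) :
    ∃ f : Fin (c * M) → Fin 3 → Fin M, Expands (tripartite f) s := by
  classical
  by_contra! hall
  set bad : Finset (Fin (c * M)) → Finset (Fin 3 × Fin M) → Finset (Fin (c * M) → Fin 3 → Fin M) :=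
    fun T Q => Finset.univ.filter fun f => ∀ c ∈ T, ∀ i, tripartite f c i ∈ Q with hbad
  have hMs : ∀ t : ℕ, t ≤ 2 * s → 2 * (t : ℝ) ≤ y ^ 4 * M := fun t ht => by
    have : (t : ℝ) ≤ 2 * s := by exact_mod_cast ht
    linarith
  have hcover : (Finset.univ : Finset (Fin (c * M) → Fin 3 → Fin M)) ⊆
      (Finset.Icc 1 (2 * s)).biUnion fun t => (Finset.powersetCard t Finset.univ ×ˢ
        Finset.powersetCard (7 * t / 4) Finset.univ).biUnion fun p => bad p.1 p.2 := by
    intro f _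
    have hf := hall f
    unfold Expands at hf
    push Not at hf
    obtain ⟨a, ha0, ha, hle⟩ := hf
    have hU := two_mul_card_biUnion_le (tripartite f) a
    set T := Finset.univ.filter fun c => a c ≠ 0 with hT
    have hTcard : T.card = hammingNorm a := rfl
    have hqM : 7 * hammingNorm a / 4 ≤ 3 * M := by
      have h1 := hMs _ ha
      have h2 : y ^ 4 * M ≤ M := mul_le_of_le_one_left M.cast_nonneg (pow_le_one₀ hy0.le hy1)
      have h3 : 2 * hammingNorm a ≤ M := by exact_mod_cast h1.trans h2
      omega
    obtain ⟨Q, hUQ, hQ⟩ := Finset.exists_superset_card_eq (n := 7 * hammingNorm a / 4)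
      (s := T.biUnion fun c => Finset.univ.image (tripartite f c)) (by omega) (by simpa using hqM)
    simp only [Finset.mem_biUnion, Finset.mem_product, Finset.mem_powersetCard]
    refine ⟨hammingNorm a, Finset.mem_Icc.2 ⟨hammingNorm_pos_iff.2 ha0, ha⟩, (T, Q),
      ⟨⟨Finset.subset_univ _, hTcard⟩, Finset.subset_univ _, hQ⟩, ?_⟩
    simp only [hbad, Finset.mem_filter, Finset.mem_univ, true_and]
    exact fun c hc i => hUQ (Finset.mem_biUnion.2
      ⟨c, hc, Finset.mem_image_of_mem _ (Finset.mem_univ i)⟩)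
  have hterm : ∀ t ∈ Finset.Icc 1 (2 * s),
      (((Finset.powersetCard t (Finset.univ : Finset (Fin (c * M))) ×ˢ
        Finset.powersetCard (7 * t / 4) (Finset.univ : Finset (Fin 3 × Fin M))).biUnion
          fun p => bad p.1 p.2).card : ℝ) ≤ (1 / 2) ^ t * ((M : ℝ) ^ 3) ^ (c * M) := by
    intro t ht
    rw [Finset.mem_Icc] at ht
    -- Here no `t` equations exist; disposing of this case keeps the subtraction `c * M - t` honest.
    by_cases htc : c * M < t
    · rw [Finset.powersetCard_eq_empty.2 (by simpa using htc)]
      simp only [Finset.empty_product, Finset.biUnion_empty, Finset.card_empty, Nat.cast_zero]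
      positivity
    have h1 : ((Finset.powersetCard t (Finset.univ : Finset (Fin (c * M))) ×ˢ
        Finset.powersetCard (7 * t / 4) (Finset.univ : Finset (Fin 3 × Fin M))).biUnion
          fun p => bad p.1 p.2).card ≤ ((c * M).choose t * (3 * M).choose (7 * t / 4)) *
            (((7 * t / 4) ^ 3) ^ t * (M ^ 3) ^ (c * M - t)) := by
      refine (Finset.card_biUnion_le_card_mul _ _ (((7 * t / 4) ^ 3) ^ t * (M ^ 3) ^ (c * M - t))
        fun p hp => ?_).trans_eq ?_
      · simp only [Finset.mem_product, Finset.mem_powersetCard] at hp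
        have := card_filter_tripartite_le p.1 p.2
        rw [hp.1.2, hp.2.2, Fintype.card_fin] at this
        convert this
      · simp [Finset.card_product]
    have h2 := choose_mul_choose_mul_pow_le hy0 hy1 hy ht.1 (hMs t ht.2)
      (show 1 ≤ 7 * t / 4 by omega) (by omega)
    have h3 := Nat.cast_le (α := ℝ).2 h1
    refine h3.trans ?_
    rw [Nat.cast_mul, Nat.cast_mul, Nat.cast_mul, Nat.cast_pow, Nat.cast_pow, Nat.cast_pow,
      Nat.cast_pow, ← mul_assoc]
    refine (mul_le_mul_of_nonneg_right h2 (by positivity)).trans_eq ?_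
    rw [mul_assoc, ← pow_add, Nat.add_sub_cancel' (not_lt.1 htc)]
  have hcard := (Finset.card_le_card hcover).trans Finset.card_biUnion_le
  have hcard' := Nat.cast_le (α := ℝ).2 hcard
  rw [Nat.cast_sum] at hcard'
  have hcard'' := hcard'.trans (Finset.sum_le_sum hterm)
  rw [← Finset.sum_mul, Finset.card_univ] at hcard''
  simp only [Fintype.card_fun, Fintype.card_fin, Nat.cast_pow] at hcard''
  have hgeom : ∑ t ∈ Finset.Icc 1 (2 * s), (1 / 2 : ℝ) ^ t < 1 := by
    have : ∀ n : ℕ, ∑ t ∈ Finset.Icc 1 n, (1 / 2 : ℝ) ^ t = 1 - (1 / 2) ^ n := by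
      intro n
      induction n with
      | zero => simp
      | succ n ih =>
        rw [Finset.sum_Icc_succ_top (by omega), ih]
        ring
    rw [this]
    have : (0 : ℝ) < (1 / 2) ^ (2 * s) := by positivity
    linarith
  have hpos : (0 : ℝ) < ((M : ℝ) ^ 3) ^ (c * M) := by
    rcases Nat.eq_zero_or_pos M with rfl | hM
    · simp
    · positivity
  nlinarith

end ThreeXor

/-! ### Choice of parameters -/

open ThreeXor in
theorem mainTheorem1 (ε : ℝ) (hε : 0 < ε) (k : ℕ → ℕ)
    (hk : Asymptotics.IsLittleO Filter.atTop (fun n : ℕ => (k n : ℝ)) (fun n : ℕ => (n : ℝ))) :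
    ¬ CountSeparable ThreeXor.incLang k
        (ThreeXor.incClass fun I => I.Satisfiable)
        (ThreeXor.incClass fun I => ¬ I.FracSatisfiable (1 / 2 + ε)) ∧
    ¬ CountSeparable ThreeXor.varLang k
        (ThreeXor.varClass fun I => I.Satisfiable)
        (ThreeXor.varClass fun I => ¬ I.FracSatisfiable (1 / 2 + ε)) := by
  -- The density that random right-hand sides need: `3 * M < ε ^ 2 * (c * M)`.
  obtain ⟨c, hc⟩ := exists_nat_gt (3 / ε ^ 2)
  rw [div_lt_iff₀ (by positivity)] at hc
  have hc1 : (1 : ℝ) ≤ c := by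
    rcases Nat.eq_zero_or_pos c with rfl | hc0
    · norm_num at hc
    · exact_mod_cast hc0
  have he1 : 1 ≤ Real.exp 1 ^ 3 := one_le_pow₀ (Real.one_le_exp zero_le_one)
  set K : ℝ := 36 * c * Real.exp 1 ^ 3 with hK
  have hK1 : 1 ≤ K := by nlinarith
  set y : ℝ := K⁻¹ with hy
  have hy0 : 0 < y := by positivity
  have hy1 : y ≤ 1 := inv_le_one_of_one_le₀ hK1
  have hKy : K * y ≤ 1 := (mul_inv_cancel₀ (by positivity)).le
  -- Chosen so that `k n ≤ γ * n` with `n = (6 + 8 * c) * M` reads `6 * k n ≤ y ^ 4 * M / 4`, the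
  -- quantity whose floor is `s`.
  have hγ : 0 < y ^ 4 / (24 * (6 + 8 * c)) := by positivity
  obtain ⟨n₀, hn₀⟩ := Filter.eventually_atTop.1 (hk.def hγ)
  obtain ⟨M₁, hM₁⟩ := exists_nat_gt (4 / y ^ 4)
  rw [div_lt_iff₀ (by positivity)] at hM₁
  set M := max M₁ n₀ with hM
  have hMM₁ : (M₁ : ℝ) ≤ M := by exact_mod_cast le_max_left M₁ n₀
  have hM4 : 4 < y ^ 4 * M := by nlinarith [pow_pos hy0 4]
  have hM0 : (0 : ℝ) < M := pos_of_mul_pos_right (a := y ^ 4) (by linarith) (by positivity)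
  -- `6 * M` doubled variables and `8 * c * M` constraints; the second encoding is smaller and uses
  -- the same `n`.
  set n := (6 + 8 * c) * M with hn
  set s := ⌊y ^ 4 * M / 4⌋₊ with hs
  have hs4 : 4 * (s : ℝ) ≤ y ^ 4 * M := by
    have := Nat.floor_le (show 0 ≤ y ^ 4 * M / 4 by positivity)
    rw [← hs] at this
    linarith
  have hs1 : 1 ≤ s := Nat.le_floor (by push_cast; linarith)
  have hk6 : 6 * k n ≤ s := by
    refine Nat.le_floor ?_
    have h1 := hn₀ n ((le_max_right M₁ n₀).trans (Nat.le_mul_of_pos_left M (by omega)))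
    simp only [Real.norm_natCast] at h1
    rw [hn] at h1 ⊢
    push_cast at h1 ⊢
    have h2 : y ^ 4 / (24 * (6 + 8 * c)) * ((6 + 8 * c) * M) = y ^ 4 * M / 24 := by
      field_simp
    linarith
  obtain ⟨f, hf⟩ := exists_expands hy0 hy1 hKy hs4
  obtain ⟨b, hb⟩ := exists_not_fracSatisfiable_doubling (tripartite f) (tripartite_injective f)
    (ε := ε) (by simp only [Fintype.card_prod, Fintype.card_fin]; push_cast; nlinarith) hε
  set I := doubling (tripartite f) (tripartite_injective f) b with hI
  set I₀ := doubling (tripartite f) (tripartite_injective f) 0 with hI₀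
  have hcardV : ∀ b, Nat.card (doubling (tripartite f) (tripartite_injective f) b).Var = 6 * M := by
    intro b
    change Nat.card ((Fin 3 × Fin M) × ZMod 2) = _
    simp
    ring
  have hcardC : ∀ b, Nat.card (doubling (tripartite f) (tripartite_injective f) b).Con =
      8 * c * M := by
    intro b
    change Nat.card (Fin (c * M) × (Fin 3 → ZMod 2)) = _
    simp
    ring
  have hcardS : ∀ b, Nat.card ((doubling (tripartite f) (tripartite_injective f) b).Var ⊕
      (doubling (tripartite f) (tripartite_injective f) b).Con) = n := by
    intro b
    rw [Nat.card_sum, hcardV, hcardC, hn]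
    ring
  have hVn : 6 * M ≤ n := by rw [hn, add_mul]; exact Nat.le_add_right _ _
  have symm : ∀ {L : FirstOrder.Language.{0, 0}} [L.IsRelational] {A B : Type} [L.Structure A]
      [L.Structure B], CountEquiv L (k n) A B → CountEquiv L (k n) B A :=
    fun h φ hφ => (h φ hφ).symm
  constructor
  · intro hsep
    exact hsep n ⟨I₀.Var ⊕ I₀.Con, inferInstance⟩
      ⟨I₀, doubling_zero_satisfiable, ⟨FirstOrder.Language.Equiv.refl _ _⟩⟩
      ⟨I.Var ⊕ I.Con, inferInstance⟩ ⟨I, hb, ⟨FirstOrder.Language.Equiv.refl _ _⟩⟩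
      (inferInstanceAs (Finite (I₀.Var ⊕ I₀.Con))) (inferInstanceAs (Finite (I.Var ⊕ I.Con)))
      (hcardS 0).le (hcardS b).le (symm (hf.countEquiv_incLang hs1 hk6))
  · intro hsep
    exact hsep n ⟨I₀.Var, inferInstance⟩
      ⟨I₀, hf.doubling_noRepeat hs1, doubling_zero_satisfiable,
        ⟨FirstOrder.Language.Equiv.refl _ _⟩⟩
      ⟨I.Var, inferInstance⟩
      ⟨I, hf.doubling_noRepeat hs1, hb, ⟨FirstOrder.Language.Equiv.refl _ _⟩⟩
      (inferInstanceAs (Finite I₀.Var)) (inferInstanceAs (Finite I.Var))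
      ((hcardV 0).trans_le hVn) ((hcardV b).trans_le hVn) (symm (hf.countEquiv_varLang hs1 hk6))
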